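/- Let $\mathbb G$ be a homogeneous group: a finite-dimensional real Lie algebra with a direct decomposition $\mathbb G=H^1\oplus\cdots\oplus H^\iota$, $[H^i,H^j]\subset H^{i+j}$, $H^j=\{0\}$ for $j>\iota$ and $H^\iota\neq\{0\}$, equipped with the group operation given by the Baker–Campbell–Hausdorff formula, with the dilations $\delta_r$ $(r>0)$, i.e. the linear maps with $\delta_r p=r^jp$ for $p\in H^j$, and with a fixed scalar product, of norm $|\cdot|$, for which the layers $H^j$ are pairwise orthogonal. Let $d$ be a homogeneous distance on $\mathbb G$, that is, a left invariant distance with $d(\delta_rx,\delta_ry)=r\,d(x,y)$ for all $x,y\in\mathbb G$ and $r>0$, and let $\mathbb B(u,1)=\{v\in\mathbb G: d(v,u)\le 1\}$. For a linear subspace $S\subset\mathbb G$ of dimension $\mathrm n$, the spherical factor of $d$ with respect to $S$ is $$\beta_d(S)=\sup_{d(u,0)\le 1}\mathcal H^{\mathrm n}_{|\cdot|}\big(\mathbb B(u,1)\cap S\big),$$ where $\mathcal H^{\mathrm n}_{|\cdot|}$ is the $\mathrm n$-dimensional Hausdorff measure with respect to $|\cdot|$, normalized by the factor $\omega_{\mathrm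 n}2^{-\mathrm n}$, with $\omega_{\mathrm n}$ the Lebesgue measure of the unit ball of $\mathbb R^{\mathrm n}$. **Theorem 1.2.** Suppose that the metric unit ball $\mathbb B(0,1)$ is convex, and let $N\subset\mathbb G$ be an $\mathrm n$-dimensional vertical subgroup, that is, a homogeneous subgroup (a linear subspace invariant under all dilations that is also a subgroup) of the form $N=N_\ell\oplus H^{\ell+1}\oplus\cdots\oplus H^\iota$ with $\ell\in\{1,\dots,\iota\}$ and $N_\ell$ a linear subspace of $H^\ell$. Then the supremum defining $\beta_d(N)$ is finite and is a maximum, and $$\beta_d(N)=\mathcal H^{\mathrm n}_{|\cdot|}\big(N\cap\mathbb B(0,1)\big).$$ -/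

import Mathlib

open MeasureTheory

noncomputable section

/-! ### Lie algebras carrying a compatible Euclidean structure -/

/-- A normed additive group and a Lie ring on the same underlying additive group. -/
class NormedLieRing (G : Type*) extends NormedAddCommGroup G, LieRing G

/-- A real Lie algebra that is also a real inner product space, with one common vector space
structure.  No relation between the bracket and the inner product is required. -/
class InnerLieAlgebra (G : Type*) [NormedLieRing G] extends
  InnerProductSpace ℝ G, LieAlgebra ℝ G

/-! ### The Baker-Campbell-Hausdorff product, in Dynkin's form -/

section BCH

variable {L : Type*} [LieRing L] [LieAlgebra ℝ L]

/-- The iterated bracket `⁅a₁, ⁅a₂, … ⁅aₘ₋₁, aₘ⁆ … ⁆⁆` of the list `[a₁, …, aₘ]`. -/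
def nestedBracket : List L → L
  | [] => 0
  | [a] => a
  | a :: b :: l => ⁅a, nestedBracket (b :: l)⁆

/-- The word `x^(r₁) y^(s₁) ⋯ x^(rₖ) y^(sₖ)`, where `p i = (rᵢ, sᵢ)`. -/
def dynkinWord {k : ℕ} (x y : L) (p : Fin k → ℕ × ℕ) : List L :=
  (List.ofFn p).flatMap fun rs => List.replicate rs.1 x ++ List.replicate rs.2 y

/-- The index set of Dynkin's formula: all `((r₁, s₁), …, (rₖ, sₖ))` with `rᵢ + sᵢ > 0` for every
`i` and `∑ᵢ (rᵢ + sᵢ) = n`. -/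
def dynkinIndex (k n : ℕ) : Finset (Fin k → ℕ × ℕ) :=
  (Fintype.piFinset fun _ => Finset.range (n + 1) ×ˢ Finset.range (n + 1)).filter fun p =>
    (∀ i, 0 < (p i).1 + (p i).2) ∧ ∑ i, ((p i).1 + (p i).2) = n

/-- The homogeneous component `cₙ(x, y)` of degree `n` of the Baker-Campbell-Hausdorff series
`log (exp x exp y)`, by Dynkin's formula
`cₙ(x, y) = (1/n) ∑ₖ ((-1)^(k-1)/k) ∑ₚ (∏ᵢ rᵢ! sᵢ!)⁻¹ [x^(r₁) y^(s₁) ⋯ x^(rₖ) y^(sₖ)]`. -/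
def bchTerm (n : ℕ) (x y : L) : L :=
  (1 / (n : ℝ)) • ∑ k ∈ Finset.Icc 1 n, ((-1 : ℝ) ^ (k - 1) / (k : ℝ)) •
    ∑ p ∈ dynkinIndex k n,
      (1 / ∏ i, (((p i).1.factorial : ℝ) * ((p i).2.factorial : ℝ))) •
        nestedBracket (dynkinWord x y p)

end BCH

/-! ### Homogeneous groups -/

/-- A homogeneous group, in exponential coordinates, together with a graded scalar product:
a direct decomposition `G = H¹ ⊕ ⋯ ⊕ H^ι` of a Lie algebra `G` with `⁅Hⁱ, Hʲ⁆ ⊆ Hⁱ⁺ʲ`, `Hʲ = 0`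
for `j > ι` and `H^ι ≠ 0`, whose layers are pairwise orthogonal for the inner product of `G`.
The layers are indexed by `ℕ`, with `H⁰ = 0`.  The group operation is `HomogeneousGroup.mul`. -/
structure HomogeneousGroup (G : Type*) [NormedLieRing G] [InnerLieAlgebra G] where
  /-- the step `ι` -/
  step : ℕ
  /-- the layers `Hʲ` -/
  layer : ℕ → Submodule ℝ G
  isInternal : DirectSum.IsInternal layer
  layer_zero : layer 0 = ⊥
  layer_eq_bot : ∀ j, step < j → layer j = ⊥
  layer_step_ne_bot : layer step ≠ ⊥
  lie_mem : ∀ i j, ∀ x ∈ layer i, ∀ y ∈ layer j, ⁅x, y⁆ ∈ layer (i + j)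
  isOrtho : ∀ i j, i ≠ j → layer i ⟂ layer j

namespace HomogeneousGroup

variable {G : Type*} [NormedLieRing G] [InnerLieAlgebra G] (𝔾 : HomogeneousGroup G)

/-- The group operation `x y = ∑_{j = 1}^{ι} cⱼ(x, y)`.  (The terms of degree `> ι` of the
Baker-Campbell-Hausdorff series vanish.)  The unit element is `0` and the inverse of `x` is `-x`. -/
def mul (x y : G) : G := ∑ j ∈ Finset.Icc 1 𝔾.step, bchTerm j x y

theorem bijective_coeLinearMap : Function.Bijective (DirectSum.coeLinearMap 𝔾.layer) :=
  𝔾.isInternal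

/-- The linear projection of `G` onto the layer `Hʲ` along the direct sum of the other layers. -/
def proj (j : ℕ) : G →ₗ[ℝ] G :=
  (𝔾.layer j).subtype ∘ₗ DirectSum.component ℝ ℕ (fun i => 𝔾.layer i) j ∘ₗ
    (LinearEquiv.ofBijective (DirectSum.coeLinearMap 𝔾.layer) 𝔾.bijective_coeLinearMap).symm.toLinearMap

/-- The intrinsic dilation: the linear map `δ_r` with `δ_r p = rʲ p` for `p ∈ Hʲ`. -/
def dilation (r : ℝ) : G →ₗ[ℝ] G := ∑ j ∈ Finset.Icc 1 𝔾.step, r ^ j • 𝔾.proj j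

/-- A homogeneous subgroup: a linear subspace that is invariant under all dilations and is a
subgroup (inverses are negatives, so they stay in any linear subspace). -/
structure IsHomogeneousSubgroup (S : Submodule ℝ G) : Prop where
  dilation_mem : ∀ r : ℝ, 0 < r → ∀ x ∈ S, 𝔾.dilation r x ∈ S
  mul_mem : ∀ x ∈ S, ∀ y ∈ S, 𝔾.mul x y ∈ S

/-- A vertical subgroup: a homogeneous subgroup of the form `N_ℓ ⊕ H^(ℓ+1) ⊕ ⋯ ⊕ H^ι` with
`1 ≤ ℓ ≤ ι` and `N_ℓ` a linear subspace of `H^ℓ`. -/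
structure IsVerticalSubgroup (N : Submodule ℝ G) : Prop where
  isHomogeneousSubgroup : 𝔾.IsHomogeneousSubgroup N
  eq_sup : ∃ l ∈ Finset.Icc 1 𝔾.step, ∃ Nl : Submodule ℝ G, Nl ≤ 𝔾.layer l ∧
    N = Nl ⊔ ⨆ j ∈ Finset.Ioc l 𝔾.step, 𝔾.layer j

/-- A homogeneous distance: a distance on `G` that is invariant under left translations and
satisfies `d (δ_r x) (δ_r y) = r d x y` for `r > 0`. -/
structure IsHomogeneousDistance (d : G → G → ℝ) : Prop where
  dist_self : ∀ x, d x x = 0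
  eq_of_dist_eq_zero : ∀ x y, d x y = 0 → x = y
  symm : ∀ x y, d x y = d y x
  triangle : ∀ x y z, d x z ≤ d x y + d y z
  left_invariant : ∀ p x y, d (𝔾.mul p x) (𝔾.mul p y) = d x y
  homogeneous : ∀ r : ℝ, 0 < r → ∀ x y, d (𝔾.dilation r x) (𝔾.dilation r y) = r * d x y

end HomogeneousGroup

/-- The closed ball `{q | d q p ≤ r}` of a distance `d`. -/
def dClosedBall {G : Type*} (d : G → G → ℝ) (p : G) (r : ℝ) : Set G := {q | d q p ≤ r}

/-- The Euclidean `n`-dimensional Hausdorff measure: the measure built from the set function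
`S ↦ ωₙ (diam S / 2)ⁿ` with `ωₙ` the Lebesgue measure of the unit ball of `ℝⁿ`. -/
def euclideanHausdorff (G : Type*) [NormedAddCommGroup G] [MeasurableSpace G] [BorelSpace G]
    (n : ℕ) : Measure G :=
  (volume (Metric.closedBall (0 : EuclideanSpace ℝ (Fin n)) 1) / 2 ^ n) • μH[(n : ℝ)]

/-- The spherical factor `β_d(S)` of `d` with respect to a linear subspace `S` of dimension `n`:
the supremum of the Euclidean `n`-areas of the sections by `S` of the closed unit balls whose
centre `u` satisfies `d u 0 ≤ 1`. -/
def sphericalFactor {G : Type*} [NormedAddCommGroup G] [InnerProductSpace ℝ G]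
    [MeasurableSpace G] [BorelSpace G] (d : G → G → ℝ) (S : Submodule ℝ G) : ENNReal :=
  ⨆ u ∈ dClosedBall d 0 1,
    euclideanHausdorff G (Module.finrank ℝ S) (dClosedBall d u 1 ∩ (S : Set G))

end

/-! Write the product as `x + y + Q(x, y)`, with `Q = mulBracketPart`. A vertical subgroup `N` lies
between two consecutive members of the descending filtration by layers (`tail`), so `Q(-u, v) ∈ N`
for every `u ∈ G` and `v ∈ N`. Left translation by `-u` therefore carries the section of `𝔹(u,1)` by
`N` into `𝔹(0,1) ∩ (N - u)`. Up to the shift by `-u` it is the map `v ↦ v + Q(-u, v)` of `N`; its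
differential is the identity plus a nilpotent map, so it preserves volume
(`addHaar_image_left_translation`).

It remains to compare parallel sections of one set, `𝔹(0,1)`, which is convex and, since inverses
are negatives, symmetric. The midpoints between the section over `-u` and its reflection lie in the
central section, so the multiplicative Brunn-Minkowski inequality (`addHaar_mul_le_sq_of_midpoint`)
shows that the central section is largest. Hence `u = 0` realizes the supremum. Finiteness follows
from boundedness of the unit ball (`isBounded_ball`). -/

/-! ### Brunn-Minkowski and Prékopa-Leindler inequalities for midpoints. -/

/-- With `a = max K` and `b = min L`, the half-size copies `(K + b)/2` and `(L + a)/2` both lie in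
`C`, on opposite sides of their only possible common point `(a + b)/2`. -/
theorem Real.volume_add_volume_le_of_isCompact {K L C : Set ℝ} (hK : IsCompact K)
    (hL : IsCompact L) (hKne : K.Nonempty) (hLne : L.Nonempty)
    (hC : ∀ x ∈ K, ∀ y ∈ L, (x + y) / 2 ∈ C) :
    volume K + volume L ≤ 2 * volume C := by
  obtain ⟨a, haK, ha⟩ := hK.exists_isGreatest hKne
  obtain ⟨b, hbL, hb⟩ := hL.exists_isLeast hLne
  have himage : ∀ (c : ℝ) (s : Set ℝ),
      volume ((fun x : ℝ => (x + c) / 2) '' s) = 2⁻¹ * volume s := by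
    intro c s
    have : (fun x : ℝ => (x + c) / 2) = (fun x => x + c / 2) ∘ (fun x => (2⁻¹ : ℝ) • x) := by
      funext x; simp; ring
    rw [this, Set.image_comp, Set.image_add_right, measure_preimage_add_right,
      Set.image_smul, Measure.addHaar_smul]
    simp
  have hcont : ∀ c : ℝ, Continuous fun x : ℝ => (x + c) / 2 := fun c => by fun_prop
  have hdisj : AEDisjoint volume ((fun x : ℝ => (x + b) / 2) '' K)
      ((fun x : ℝ => (x + a) / 2) '' L) := by
    refine measure_mono_null (t := {(a + b) / 2}) ?_ (by simp)
    rintro z ⟨⟨x, hx, rfl⟩, ⟨y, hy, h⟩⟩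
    have h1 := ha hx
    have h2 := hb hy
    simp only [Set.mem_singleton_iff] at h ⊢
    linarith
  have hunion : (fun x : ℝ => (x + b) / 2) '' K ∪ (fun x : ℝ => (x + a) / 2) '' L ⊆ C := by
    rintro z (⟨x, hx, rfl⟩ | ⟨y, hy, rfl⟩)
    · exact hC x hx b hbL
    · simpa [add_comm] using hC a haK y hy
  have key := measure_mono (μ := volume) hunion
  rw [measure_union₀ (hL.image (hcont a)).measurableSet.nullMeasurableSet hdisj, himage, himage,
    ← mul_add] at key
  calc volume K + volume L = 2 * (2⁻¹ * (volume K + volume L)) := by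
        rw [← mul_assoc, ENNReal.mul_inv_cancel (by simp) (by simp), one_mul]
    _ ≤ 2 * volume C := by gcongr

theorem Real.volume_add_volume_le {A B C : Set ℝ} (hA : MeasurableSet A) (hB : MeasurableSet B)
    (hAne : A.Nonempty) (hBne : B.Nonempty) (hC : ∀ x ∈ A, ∀ y ∈ B, (x + y) / 2 ∈ C) :
    volume A + volume B ≤ 2 * volume C := by
  obtain ⟨a, ha⟩ := hAne
  obtain ⟨b, hb⟩ := hBne
  rw [hA.measure_eq_iSup_isCompact, hB.measure_eq_iSup_isCompact]
  simp only [iSup_and']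
  refine ENNReal.biSup_add_biSup_le' ⟨∅, by simp⟩ ⟨∅, by simp⟩ ?_
  rintro K ⟨hKA, hK⟩ L ⟨hLB, hL⟩
  -- Adjoining `a` and `b` keeps the approximating compact sets nonempty.
  refine le_trans (add_le_add (measure_mono (Set.subset_insert a K))
    (measure_mono (Set.subset_insert b L))) ?_
  refine volume_add_volume_le_of_isCompact (hK.insert a) (hL.insert b) (Set.insert_nonempty _ _)
    (Set.insert_nonempty _ _) fun x hx y hy => hC x ?_ y ?_
  · exact Set.insert_subset ha hKA hx
  · exact Set.insert_subset hb hLB hy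

theorem ENNReal.mul_le_sq_of_add_le_two_mul {x y z : ENNReal} (h : x + y ≤ 2 * z) :
    x * y ≤ z ^ 2 := by
  rcases eq_or_ne z ⊤ with rfl | hz
  · simp
  have h2 : x + y ≠ ⊤ := ne_top_of_le_ne_top (ENNReal.mul_ne_top (by simp) hz) h
  obtain ⟨hx, hy⟩ := ENNReal.add_ne_top.1 h2
  lift x to NNReal using hx
  lift y to NNReal using hy
  lift z to NNReal using hz
  norm_cast at h ⊢
  have h' : (x : ℝ) + y ≤ 2 * z := by exact_mod_cast h
  have : (x : ℝ) * y ≤ z ^ 2 := by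
    nlinarith [sq_nonneg ((x : ℝ) - y), x.2, y.2, z.2, mul_self_le_mul_self (by positivity) h']
  exact_mod_cast this

/-- The Prékopa-Leindler inequality on the line for functions of supremum one. -/
theorem lintegral_add_lintegral_le_of_iSup_eq_one {f g h : ℝ → ENNReal} (hf : Measurable f)
    (hg : Measurable g) (hh : Measurable h) (hf1 : ⨆ x, f x = 1) (hg1 : ⨆ x, g x = 1)
    (hh1 : ∀ x, h x ≤ 1) (H : ∀ x y, f x * g y ≤ h ((x + y) / 2) ^ 2) :
    (∫⁻ x, f x) + ∫⁻ x, g x ≤ 2 * ∫⁻ x, h x := by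
  -- Layer-cake formula: the claim reduces to the set inequality for superlevel sets at each height
  -- `t`.
  have layer : ∀ k : ℝ → ENNReal, Measurable k → (∀ x, k x ≤ 1) →
      ∫⁻ x, k x = ∫⁻ t in Set.Ioi (0 : ℝ), volume {x | ENNReal.ofReal t < k x} := by
    intro k hk hk1
    have hfin : ∀ x, k x ≠ ⊤ := fun x => ne_top_of_le_ne_top (by simp) (hk1 x)
    have := lintegral_eq_lintegral_meas_lt volume (f := fun x => (k x).toReal)
      (Filter.Eventually.of_forall fun x => by positivity) hk.ennreal_toReal.aemeasurable
    simp only [ENNReal.ofReal_toReal (hfin _)] at this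
    rw [this]
    refine setLIntegral_congr_fun measurableSet_Ioi fun t ht => ?_
    simp only [ENNReal.ofReal_lt_iff_lt_toReal (le_of_lt ht) (hfin _)]
  have hf1' : ∀ x, f x ≤ 1 := fun x => hf1 ▸ le_iSup f x
  have hg1' : ∀ x, g x ≤ 1 := fun x => hg1 ▸ le_iSup g x
  rw [layer f hf hf1', layer g hg hg1', layer h hh hh1]
  have hmeas : ∀ k : ℝ → ENNReal,
      Measurable fun t : ℝ => volume {x | ENNReal.ofReal t < k x} := fun k =>
    Antitone.measurable fun s t hst => measure_mono fun x (hx : _ < _) =>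
      lt_of_le_of_lt (ENNReal.ofReal_le_ofReal hst) hx
  rw [← lintegral_add_left (hmeas f), ← lintegral_const_mul _ (hmeas h)]
  refine setLIntegral_mono' measurableSet_Ioi fun t ht => ?_
  rcases le_or_gt 1 (ENNReal.ofReal t) with h1 | h1
  · have : ∀ k : ℝ → ENNReal, (∀ x, k x ≤ 1) → {x | ENNReal.ofReal t < k x} = ∅ := fun k hk =>
      Set.eq_empty_of_forall_notMem fun x (hx : _ < _) =>
        absurd (h1.trans_lt (hx.trans_le (hk x))) (lt_irrefl _)
    rw [this f hf1', this g hg1']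
    simp
  -- Since both suprema equal one, the superlevel sets of `f` and `g` at any height `t < 1` are both
  -- nonempty, as the set inequality requires.
  · refine Real.volume_add_volume_le (measurableSet_lt measurable_const hf)
      (measurableSet_lt measurable_const hg) ?_ ?_ ?_
    · exact lt_iSup_iff.1 (hf1.symm ▸ h1)
    · exact lt_iSup_iff.1 (hg1.symm ▸ h1)
    · intro x hx y hy
      have hx' : ENNReal.ofReal t < f x := hx
      have hy' : ENNReal.ofReal t < g y := hy
      have h2 : ENNReal.ofReal t ^ 2 < h ((x + y) / 2) ^ 2 := by
        rw [pow_two (ENNReal.ofReal t)]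
        exact (ENNReal.mul_lt_mul hx' hy').trans_le (H x y)
      exact lt_of_not_ge fun h3 => absurd (pow_le_pow_left' h3 2) (not_le.2 h2)

/-- Dividing `f`, `g`, `h` by `sup f`, `sup g` and the geometric mean `c` of these suprema reduces
to suprema equal to one; AM-GM then turns the additive inequality into the multiplicative one. -/
theorem prekopa_leindler_real_of_bounded {f g h : ℝ → ENNReal} (hf : Measurable f)
    (hg : Measurable g) (hh : Measurable h) (hf1 : ⨆ x, f x ≠ ⊤) (hg1 : ⨆ x, g x ≠ ⊤)
    (H : ∀ x y, f x * g y ≤ h ((x + y) / 2) ^ 2) :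
    (∫⁻ x, f x) * ∫⁻ x, g x ≤ (∫⁻ x, h x) ^ 2 := by
  set a := ⨆ x, f x with ha
  set b := ⨆ x, g x with hb
  rcases eq_or_ne a 0 with ha0 | ha0
  · have : ∀ x, f x = 0 := by simpa [ha0] using ha.symm
    simp [this]
  rcases eq_or_ne b 0 with hb0 | hb0
  · have : ∀ x, g x = 0 := by simpa [hb0] using hb.symm
    simp [this]
  set c : ENNReal := (a * b) ^ (1 / 2 : ℝ) with hc
  have hc2 : c ^ 2 = a * b := by
    rw [hc, ← ENNReal.rpow_natCast, ← ENNReal.rpow_mul]; norm_num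
  have hab0 : a * b ≠ 0 := mul_ne_zero ha0 hb0
  have habt : a * b ≠ ⊤ := ENNReal.mul_ne_top hf1 hg1
  have hc0 : c ≠ 0 := fun h0 => hab0 (by rw [← hc2, h0]; simp)
  have hct : c ≠ ⊤ := fun h0 => habt (by rw [← hc2, h0]; simp)
  have hcinv : c⁻¹ ^ 2 = a⁻¹ * b⁻¹ := by
    rw [← ENNReal.inv_pow, hc2, ENNReal.mul_inv (Or.inl ha0) (Or.inl hf1)]
  -- Truncating the normalized `h` at `1` preserves the hypothesis, because the normalized `f` and
  -- `g` are at most `1`.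
  have key := lintegral_add_lintegral_le_of_iSup_eq_one (f := fun x => a⁻¹ * f x)
    (g := fun x => b⁻¹ * g x) (h := fun x => min (c⁻¹ * h x) 1) (hf.const_mul _)
    (hg.const_mul _) ((hh.const_mul _).min measurable_const)
    (by rw [← ENNReal.mul_iSup, ← ha, ENNReal.inv_mul_cancel ha0 hf1])
    (by rw [← ENNReal.mul_iSup, ← hb, ENNReal.inv_mul_cancel hb0 hg1])
    (fun x => min_le_right _ _) (fun x y => by
      have h1 : a⁻¹ * f x ≤ 1 := by
        rw [← ENNReal.inv_mul_cancel ha0 hf1]; gcongr; exact le_iSup f x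
      have h2 : b⁻¹ * g y ≤ 1 := by
        rw [← ENNReal.inv_mul_cancel hb0 hg1]; gcongr; exact le_iSup g y
      rcases min_choice (c⁻¹ * h ((x + y) / 2)) 1 with h3 | h3 <;> rw [h3]
      · rw [mul_pow, hcinv, mul_mul_mul_comm]
        gcongr
        exact H x y
      · rw [one_pow]; exact mul_le_one' h1 h2)
  have key2 := ENNReal.mul_le_sq_of_add_le_two_mul key
  rw [lintegral_const_mul _ hf, lintegral_const_mul _ hg] at key2
  have key3 : a⁻¹ * (∫⁻ x, f x) * (b⁻¹ * ∫⁻ x, g x) ≤ (c⁻¹ * ∫⁻ x, h x) ^ 2 := by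
    refine key2.trans ?_
    rw [← lintegral_const_mul _ hh]
    gcongr
    exact min_le_left _ _
  rw [mul_pow, hcinv, mul_mul_mul_comm, ← ENNReal.mul_inv (Or.inl ha0) (Or.inl hf1)] at key3
  rwa [ENNReal.mul_le_mul_iff_right (ENNReal.inv_ne_zero.2 habt) (ENNReal.inv_ne_top.2 hab0)]
    at key3

/-- The Prékopa-Leindler inequality on the line, for midpoints. -/
theorem prekopa_leindler_real {f g h : ℝ → ENNReal} (hf : Measurable f)
    (hg : Measurable g) (hh : Measurable h) (H : ∀ x y, f x * g y ≤ h ((x + y) / 2) ^ 2) :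
    (∫⁻ x, f x) * ∫⁻ x, g x ≤ (∫⁻ x, h x) ^ 2 := by
  -- Monotone convergence along the truncations `min k m` removes the boundedness assumption.
  have hsup : ∀ k : ℝ → ENNReal, Measurable k →
      ∫⁻ x, k x = ⨆ m : ℕ, ∫⁻ x, min (k x) m := by
    intro k hk
    rw [← lintegral_iSup (fun m => hk.min measurable_const)
      (fun m m' hm x => min_le_min_left _ (by exact_mod_cast hm))]
    congr with x
    change k x = ⨆ m : ℕ, k x ⊓ m
    rw [← inf_iSup_eq, ENNReal.iSup_natCast, inf_top_eq]
  rw [hsup f hf, hsup g hg, ENNReal.iSup_mul]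
  refine iSup_le fun m => ?_
  rw [ENNReal.mul_iSup]
  refine iSup_le fun k => ?_
  refine prekopa_leindler_real_of_bounded (hf.min measurable_const) (hg.min measurable_const) hh
    ?_ ?_ fun x y => le_trans (mul_le_mul' (min_le_left _ _) (min_le_left _ _)) (H x y)
  · exact ne_top_of_le_ne_top (ENNReal.natCast_ne_top m) (iSup_le fun x => min_le_right _ _)
  · exact ne_top_of_le_ne_top (ENNReal.natCast_ne_top k) (iSup_le fun x => min_le_right _ _)

/-- Induction by Fubini: the inequality in dimension `n` on the fibres is exactly the hypothesis of
the one-dimensional inequality for the fibre integrals. -/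
theorem prekopa_leindler_pi (n : ℕ) {f g h : (Fin n → ℝ) → ENNReal} (hf : Measurable f)
    (hg : Measurable g) (hh : Measurable h)
    (H : ∀ x y, f x * g y ≤ h ((2⁻¹ : ℝ) • (x + y)) ^ 2) :
    (∫⁻ x, f x) * ∫⁻ x, g x ≤ (∫⁻ x, h x) ^ 2 := by
  induction n with
  | zero =>
    have hvol : (volume : Measure (Fin 0 → ℝ)) Set.univ = 1 := by
      rw [volume_pi, Measure.pi_univ, Finset.univ_eq_empty, Finset.prod_empty]
    simp only [lintegral_unique, hvol, mul_one]
    refine (H _ _).trans_eq ?_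
    exact congrArg (fun z => h z ^ 2) (Subsingleton.elim _ _)
  | succ n ih =>
    let e := (MeasurableEquiv.piFinSuccAbove (fun _ : Fin (n + 1) => ℝ) 0).symm
    have hint : ∀ k : (Fin (n + 1) → ℝ) → ENNReal, Measurable k →
        ∫⁻ x, k x = ∫⁻ t : ℝ, ∫⁻ z : Fin n → ℝ, k (e (t, z)) := by
      intro k hk
      rw [← ((volume_preserving_piFinSuccAbove (fun _ : Fin (n + 1) => ℝ) 0).symm).lintegral_comp hk]
      exact lintegral_prod _ (hk.comp e.measurable).aemeasurable
    have hk2 : ∀ k : (Fin (n + 1) → ℝ) → ENNReal, Measurable k →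
        Measurable fun p : ℝ × (Fin n → ℝ) => k (e p) := fun k hk => hk.comp e.measurable
    have hmid : ∀ s t (z w : Fin n → ℝ),
        (2⁻¹ : ℝ) • (e (s, z) + e (t, w)) = e ((s + t) / 2, (2⁻¹ : ℝ) • (z + w)) := by
      intro s t z w
      funext i
      refine Fin.cases ?_ (fun j => ?_) i <;> simp [e] <;> ring
    rw [hint f hf, hint g hg, hint h hh]
    refine prekopa_leindler_real (hk2 f hf).lintegral_prod_right' (hk2 g hg).lintegral_prod_right'
      (hk2 h hh).lintegral_prod_right' fun s t => ?_
    refine ih ((hk2 f hf).comp measurable_prodMk_left) ((hk2 g hg).comp measurable_prodMk_left)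
      ((hk2 h hh).comp measurable_prodMk_left) fun z w => ?_
    simpa only [hmid] using H (e (s, z)) (e (t, w))

/-- The multiplicative Brunn-Minkowski inequality for midpoints. -/
theorem addHaar_mul_le_sq_of_midpoint {E : Type*} [NormedAddCommGroup E] [NormedSpace ℝ E]
    [FiniteDimensional ℝ E] [MeasurableSpace E] [BorelSpace E] (μ : Measure E)
    [μ.IsAddHaarMeasure] {A B C : Set E} (hA : MeasurableSet A) (hB : MeasurableSet B)
    (hC : MeasurableSet C) (H : ∀ x ∈ A, ∀ y ∈ B, (2⁻¹ : ℝ) • (x + y) ∈ C) :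
    μ A * μ B ≤ μ C ^ 2 := by
  let e : E ≃L[ℝ] (Fin (Module.finrank ℝ E) → ℝ) :=
    ContinuousLinearEquiv.ofFinrankEq (by simp)
  -- In coordinates `μ` is a constant multiple of Lebesgue measure; the constant enters squared on
  -- both sides of the claim.
  have hmap : ∀ s : Set E, MeasurableSet s →
      μ s = (μ.map e).addHaarScalarFactor volume * volume (e.symm ⁻¹' s) := by
    intro s hs
    have h1 : μ s = (μ.map e) (e.symm ⁻¹' s) := by
      rw [Measure.map_apply e.continuous.measurable (e.symm.continuous.measurable hs),
        ← Set.preimage_comp]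
      simp
    have : (μ.map e).IsAddHaarMeasure := e.isAddHaarMeasure_map μ
    rw [h1]
    conv_lhs => rw [Measure.isAddLeftInvariant_eq_smul (μ.map e) volume]
    rw [Measure.smul_apply, ENNReal.smul_def, smul_eq_mul]
  have hmeas : ∀ s : Set E, MeasurableSet s → MeasurableSet (e.symm ⁻¹' s) :=
    fun s hs => e.symm.continuous.measurable hs
  have key := prekopa_leindler_pi _ (f := (e.symm ⁻¹' A).indicator 1)
    (g := (e.symm ⁻¹' B).indicator 1) (h := (e.symm ⁻¹' C).indicator 1)
    (measurable_one.indicator (hmeas A hA)) (measurable_one.indicator (hmeas B hB))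
    (measurable_one.indicator (hmeas C hC)) fun x y => by
      by_cases hx : e.symm x ∈ A
      · by_cases hy : e.symm y ∈ B
        · have := H _ hx _ hy
          rw [← map_add, ← map_smul] at this
          rw [Set.indicator_of_mem (s := e.symm ⁻¹' C) this]
          simp [Set.indicator, hx, hy]
        · simp [Set.indicator, hy]
      · simp [Set.indicator, hx]
  simp only [lintegral_indicator_one (hmeas _ hA), lintegral_indicator_one (hmeas _ hB),
    lintegral_indicator_one (hmeas _ hC)] at key
  rw [hmap A hA, hmap B hB, hmap C hC, mul_pow, mul_mul_mul_comm, pow_two]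
  gcongr

/-! ### Bracket words and the terms of the Baker-Campbell-Hausdorff series. -/

section BracketWords

theorem forall₂_dynkinWord {L : Type*} {k : ℕ} {R : L → L → Prop} {x y x' y' : L} (hx : R x x')
    (hy : R y y') (p : Fin k → ℕ × ℕ) :
    List.Forall₂ R (dynkinWord x y p) (dynkinWord x' y' p) := by
  unfold dynkinWord
  have hrep : ∀ {a b : L}, R a b → ∀ n : ℕ,
      List.Forall₂ R (List.replicate n a) (List.replicate n b) := by
    intro a b hab n
    induction n with
    | zero => exact List.Forall₂.nil
    | succ n ih => exact List.Forall₂.cons hab ih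
  induction List.ofFn p with
  | nil => exact List.Forall₂.nil
  | cons q l ih =>
    simp only [List.flatMap_cons]
    exact List.rel_append (List.rel_append (hrep hx _) (hrep hy _)) ih

theorem mem_dynkinWord {L : Type*} {k : ℕ} {x y a : L} {p : Fin k → ℕ × ℕ} (ha : a ∈ dynkinWord x y p) :
    a = x ∨ a = y := by
  simp only [dynkinWord, List.mem_flatMap, List.mem_append, List.mem_replicate] at ha
  obtain ⟨_, _, h | h⟩ := ha
  · exact Or.inl h.2
  · exact Or.inr h.2

theorem length_dynkinWord {L : Type*} {k n : ℕ} (x y : L) {p : Fin k → ℕ × ℕ} (hp : p ∈ dynkinIndex k n) :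
    (dynkinWord x y p).length = n := by
  simp only [dynkinIndex, Finset.mem_filter] at hp
  simp [dynkinWord, List.length_flatMap, List.sum_ofFn, hp.2.2, Function.comp_def, List.map_ofFn]

variable {L : Type*} [LieRing L] [LieAlgebra ℝ L]

/-- Each bracket gains a step from `I` to `J`, since `⁅a, β⁆ - ⁅a', β'⁆ = ⁅a', β - β'⁆ - ⁅β, a -
a'⁆`. It serves with `I`, `J` consecutive members of the filtration by layers. -/
theorem nestedBracket_sub_mem {I J : Submodule ℝ L} (hJI : J ≤ I)
    (hI : ∀ x : L, ∀ y ∈ I, ⁅x, y⁆ ∈ J) {l l' : List L}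
    (h : List.Forall₂ (fun a b => a - b ∈ I) l l') :
    nestedBracket l - nestedBracket l' ∈ I ∧
      (2 ≤ l.length → nestedBracket l - nestedBracket l' ∈ J) := by
  induction h with
  | nil => simp [nestedBracket]
  | @cons a a' l l' ha hl ih =>
    cases hl with
    | nil => simpa [nestedBracket] using ha
    | @cons b b' l l' hb hl =>
      have key : nestedBracket (a :: b :: l) - nestedBracket (a' :: b' :: l') ∈ J := by
        simp only [nestedBracket]
        have : ⁅a, nestedBracket (b :: l)⁆ - ⁅a', nestedBracket (b' :: l')⁆ =
            ⁅a', nestedBracket (b :: l) - nestedBracket (b' :: l')⁆ -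
              ⁅nestedBracket (b :: l), a - a'⁆ := by
          rw [← lie_skew (nestedBracket (b :: l)) (a - a')]
          simp only [lie_sub, sub_lie]
          abel
        rw [this]
        exact J.sub_mem (hI _ _ ih.1) (hI _ _ ha)
      exact ⟨hJI key, fun _ => key⟩

/-- Vectors on one line commute; this is what yields `x · 0 = x` and `(-x) · x = 0`. -/
theorem nestedBracket_mem_span_singleton {u : L} {l : List L} (h : ∀ a ∈ l, a ∈ ℝ ∙ u) :
    nestedBracket l ∈ ℝ ∙ u ∧ (2 ≤ l.length → nestedBracket l = 0) := by
  induction l with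
  | nil => simp [nestedBracket]
  | cons a l ih =>
    cases l with
    | nil => simpa [nestedBracket] using h
    | cons b l =>
      obtain ⟨s, hs⟩ := Submodule.mem_span_singleton.1 (h a (by simp))
      obtain ⟨t, ht⟩ := Submodule.mem_span_singleton.1
        (ih fun c hc => h c (List.mem_cons_of_mem _ hc)).1
      have key : nestedBracket (a :: b :: l) = 0 := by
        simp only [nestedBracket]
        rw [← hs, ← ht]
        simp
      exact ⟨key ▸ Submodule.zero_mem _, fun _ => key⟩

theorem bchTerm_sub_mem {I J : Submodule ℝ L} (hJI : J ≤ I)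
    (hI : ∀ x : L, ∀ y ∈ I, ⁅x, y⁆ ∈ J) {n : ℕ} (hn : 2 ≤ n) {x y x' y' : L}
    (hx : x - x' ∈ I) (hy : y - y' ∈ I) : bchTerm n x y - bchTerm n x' y' ∈ J := by
  unfold bchTerm
  rw [← smul_sub, ← Finset.sum_sub_distrib]
  refine J.smul_mem _ (J.sum_mem fun k _ => ?_)
  rw [← smul_sub, ← Finset.sum_sub_distrib]
  refine J.smul_mem _ (J.sum_mem fun p hp => ?_)
  rw [← smul_sub]
  exact J.smul_mem _ ((nestedBracket_sub_mem hJI hI (forall₂_dynkinWord hx hy p)).2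
    (by rwa [length_dynkinWord x y hp]))

theorem bchTerm_eq_zero_of_mem_span_singleton {n : ℕ} (hn : 2 ≤ n) {u x y : L}
    (hx : x ∈ ℝ ∙ u) (hy : y ∈ ℝ ∙ u) : bchTerm n x y = 0 := by
  unfold bchTerm
  refine smul_eq_zero_of_right _ (Finset.sum_eq_zero fun k _ => smul_eq_zero_of_right _
    (Finset.sum_eq_zero fun p hp => smul_eq_zero_of_right _
      ((nestedBracket_mem_span_singleton (u := u) fun a ha => ?_).2
        (by rwa [length_dynkinWord x y hp]))))
  rcases mem_dynkinWord ha with rfl | rfl <;> assumption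

theorem bchTerm_one (x y : L) : bchTerm 1 x y = x + y := by
  have h : dynkinIndex 1 1 = {fun _ => (1, 0), fun _ => (0, 1)} := by decide
  have hne : (fun _ : Fin 1 => ((1, 0) : ℕ × ℕ)) ≠ fun _ => (0, 1) := by decide
  simp [bchTerm, h, Finset.sum_pair hne, dynkinWord, nestedBracket]

end BracketWords

/-! ### Differentiability of bracket polynomials. -/

section Differentiability

variable {G : Type*} [NormedLieRing G] [InnerLieAlgebra G] [FiniteDimensional ℝ G]

theorem Differentiable.lie {E : Type*} [NormedAddCommGroup E] [NormedSpace ℝ E] {f g : E → G}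
    (hf : Differentiable ℝ f) (hg : Differentiable ℝ g) :
    Differentiable ℝ fun v => ⁅f v, g v⁆ := by
  let B : G →ₗ[ℝ] G →ₗ[ℝ] G := LinearMap.mk₂ ℝ (fun x y => ⁅x, y⁆) add_lie smul_lie lie_add
    (fun c x y => lie_smul c x y)
  have hB := (LinearMap.toContinuousBilinearMap B).isBoundedBilinearMap.differentiable
  exact hB.comp (hf.prodMk hg)

theorem differentiable_nestedBracket {E : Type*} [NormedAddCommGroup E] [NormedSpace ℝ E]
    (l : List (E → G)) (hl : ∀ f ∈ l, Differentiable ℝ f) :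
    Differentiable ℝ fun v => nestedBracket (l.map fun f => f v) := by
  induction l with
  | nil => exact differentiable_const _
  | cons f l ih =>
    cases l with
    | nil => exact hl f (by simp)
    | cons g l =>
      exact (hl f (by simp)).lie (ih fun h hh => hl h (List.mem_cons_of_mem _ hh))

theorem differentiable_bchTerm {E : Type*} [NormedAddCommGroup E] [NormedSpace ℝ E] (n : ℕ)
    {f g : E → G} (hf : Differentiable ℝ f) (hg : Differentiable ℝ g) :
    Differentiable ℝ fun v => bchTerm n (f v) (g v) := by
  unfold bchTerm
  refine Differentiable.const_smul (Differentiable.fun_sum fun k _ => Differentiable.const_smul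
    (Differentiable.fun_sum fun p _ => Differentiable.const_smul ?_ _) _) _
  have h := differentiable_nestedBracket
    ((List.ofFn p).flatMap fun rs => List.replicate rs.1 f ++ List.replicate rs.2 g) (by
      intro h hh
      simp only [List.mem_flatMap, List.mem_append, List.mem_replicate] at hh
      obtain ⟨_, _, h | h⟩ := hh
      · exact h.2 ▸ hf
      · exact h.2 ▸ hg)
  simpa only [dynkinWord, List.map_flatMap, List.map_append, List.map_replicate] using h

end Differentiability

/-! ### Volume preservation by unipotent maps. -/

section Unipotent

variable {E : Type*} [NormedAddCommGroup E] [NormedSpace ℝ E] [FiniteDimensional ℝ E]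

/-- The determinant is the characteristic polynomial of `-f`, a power of `X`, evaluated at `1`. -/
theorem LinearMap.det_one_add_of_isNilpotent {K V : Type*} [Field K] [AddCommGroup V] [Module K V]
    [FiniteDimensional K V] {f : Module.End K V} (hf : IsNilpotent f) :
    LinearMap.det (1 + f) = 1 := by
  have h := LinearMap.eval_charpoly (-f) 1
  rw [hf.neg.charpoly_eq_X_pow_finrank] at h
  simpa using h.symm

/-- A map `id + g`, where `g` raises the degree of a finite filtration, preserves volume. -/
theorem addHaar_image_id_add_of_filtration [MeasurableSpace E] [BorelSpace E] (μ : Measure E)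
    [μ.IsAddHaarMeasure] (F : ℕ → Submodule ℝ E) (hF0 : F 0 = ⊤) {m : ℕ} (hFm : F m = ⊥)
    {g : E → E} (hg : Differentiable ℝ g)
    (hgF : ∀ j x y, x - y ∈ F j → g x - g y ∈ F (j + 1)) {s : Set E} (hs : MeasurableSet s) :
    μ ((fun x => x + g x) '' s) = μ s := by
  -- If two images agree then `x - y = -(g x - g y)`, so membership of `x - y` in `F j` improves to
  -- `F (j + 1)`, down to `F m = ⊥`.
  have hinj : Set.InjOn (fun x => x + g x) s := by
    intro x _ y _ hxy
    have h1 : x - y = -(g x - g y) := by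
      have hxy' : x + g x = y + g y := hxy
      rw [neg_sub, sub_eq_sub_iff_add_eq_add, hxy', add_comm]
    have h2 : ∀ j, x - y ∈ F j := by
      intro j
      induction j with
      | zero => simp [hF0]
      | succ j ih => rw [h1]; exact (F (j + 1)).neg_mem (hgF j x y ih)
    have h3 := h2 m
    rw [hFm, Submodule.mem_bot] at h3
    exact sub_eq_zero.1 h3
  -- The derivative is a limit of difference quotients, all in the closed subspace `F (j + 1)`; so
  -- it raises the filtration degree and is nilpotent.
  have hderiv : ∀ x h j, h ∈ F j → fderiv ℝ g x h ∈ F (j + 1) := by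
    intro x h j hh
    have h1 := ((hg x).hasFDerivAt.hasLineDerivAt h).tendsto_slope_zero
    refine (F (j + 1)).closed_of_finiteDimensional.mem_of_tendsto h1
      (Filter.Eventually.of_forall fun t => (F (j + 1)).smul_mem _ (hgF j _ _ ?_))
    simpa using (F j).smul_mem t hh
  have hdet : ∀ x, (ContinuousLinearMap.id ℝ E + fderiv ℝ g x).det = 1 := by
    intro x
    have hnil : IsNilpotent (fderiv ℝ g x : Module.End ℝ E) := by
      refine ⟨m, LinearMap.ext fun h => ?_⟩
      have : ∀ j, ((fderiv ℝ g x : Module.End ℝ E) ^ j) h ∈ F j := by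
        intro j
        induction j with
        | zero => simp [hF0]
        | succ j ih =>
          rw [pow_succ']
          exact hderiv x _ j ih
      simpa [hFm] using this m
    exact LinearMap.det_one_add_of_isNilpotent hnil
  rw [← lintegral_abs_det_fderiv_eq_addHaar_image μ hs
    (f := fun x => x + g x) (f' := fun x => ContinuousLinearMap.id ℝ E + fderiv ℝ g x)
    (fun x _ => ((hasFDerivAt_id x).fun_add (hg x).hasFDerivAt).hasFDerivWithinAt) hinj]
  simp [hdet]

end Unipotent

/-! ### Algebra and metric geometry of homogeneous groups. -/

namespace HomogeneousGroup

open Filter Topology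

variable {G : Type*} [NormedLieRing G] [InnerLieAlgebra G] (𝔾 : HomogeneousGroup G)

/-! ### The descending filtration by layers -/

/-- The sum of the layers of index at least `k`. -/
noncomputable def tail (k : ℕ) : Submodule ℝ G := ⨆ j, ⨆ _ : k ≤ j, 𝔾.layer j

theorem layer_le_tail {k j : ℕ} (h : k ≤ j) : 𝔾.layer j ≤ 𝔾.tail k :=
  le_iSup₂_of_le j h le_rfl

theorem tail_antitone : Antitone 𝔾.tail := fun _ _ h =>
  iSup₂_le fun _ hj => 𝔾.layer_le_tail (h.trans hj)

theorem iSup_layer : ⨆ j, 𝔾.layer j = ⊤ := 𝔾.isInternal.submodule_iSup_eq_top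

theorem tail_one : 𝔾.tail 1 = ⊤ := by
  rw [eq_top_iff, ← 𝔾.iSup_layer]
  refine iSup_le fun j => ?_
  rcases Nat.eq_zero_or_pos j with rfl | hj
  · simp [𝔾.layer_zero]
  · exact 𝔾.layer_le_tail hj

theorem tail_succ_step : 𝔾.tail (𝔾.step + 1) = ⊥ := by
  rw [eq_bot_iff]
  exact iSup₂_le fun j hj => (𝔾.layer_eq_bot j hj).le

/-- By bilinearity it suffices to take `x` and `y` in single layers; as `H⁰ = 0`, the layer of `x`
has index at least one. -/
theorem lie_mem_tail {k : ℕ} (x : G) {y : G} (hy : y ∈ 𝔾.tail k) : ⁅x, y⁆ ∈ 𝔾.tail (k + 1) := by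
  have hx : x ∈ 𝔾.tail 1 := by simp [tail_one]
  have hle : 𝔾.tail k ≤ (𝔾.tail (k + 1)).comap (LieModule.toEnd ℝ G G x) := by
    refine iSup₂_le fun j hj z hz => ?_
    have hle' : 𝔾.tail 1 ≤
        (𝔾.tail (k + 1)).comap ((LieModule.toEnd ℝ G G : G →ₗ[ℝ] Module.End ℝ G).flip z) :=
      iSup₂_le fun i hi w hw =>
        𝔾.layer_le_tail (by omega : k + 1 ≤ i + j) (𝔾.lie_mem i j w hw z hz)
    exact hle' hx
  exact hle hy

/-! ### Dilations -/

theorem proj_apply_self {j : ℕ} {x : G} (hx : x ∈ 𝔾.layer j) : 𝔾.proj j x = x := by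
  have h := 𝔾.isInternal.ofBijective_coeLinearMap_same ⟨x, hx⟩
  exact congrArg Subtype.val h

theorem proj_apply_of_ne {i j : ℕ} (hij : i ≠ j) {x : G} (hx : x ∈ 𝔾.layer i) :
    𝔾.proj j x = 0 := by
  have h := 𝔾.isInternal.ofBijective_coeLinearMap_of_ne hij ⟨x, hx⟩
  exact congrArg Subtype.val h

theorem dilation_apply_layer (r : ℝ) {j : ℕ} {x : G} (hx : x ∈ 𝔾.layer j) :
    𝔾.dilation r x = r ^ j • x := by
  simp only [dilation, LinearMap.sum_apply, LinearMap.smul_apply]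
  by_cases hj : j ∈ Finset.Icc 1 𝔾.step
  · rw [Finset.sum_eq_single_of_mem j hj fun i _ hi => by
      rw [𝔾.proj_apply_of_ne hi.symm hx, smul_zero], 𝔾.proj_apply_self hx]
  · have hx0 : x = 0 := by
      rcases Nat.eq_zero_or_pos j with rfl | h
      · simpa [𝔾.layer_zero] using hx
      · rw [Finset.mem_Icc, not_and, not_le] at hj
        simpa [𝔾.layer_eq_bot j (hj h)] using hx
    simp [hx0]

theorem dilation_inv_dilation {r : ℝ} (hr : r ≠ 0) (x : G) :
    𝔾.dilation r⁻¹ (𝔾.dilation r x) = x := by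
  have hle : ⨆ j, 𝔾.layer j ≤
      LinearMap.eqLocus (𝔾.dilation r⁻¹ ∘ₗ 𝔾.dilation r) LinearMap.id :=
    iSup_le fun j y hy => by
      simp [𝔾.dilation_apply_layer _ hy, smul_smul, hr]
  exact hle (by simp [𝔾.iSup_layer])

theorem dilation_zero_apply (x : G) : 𝔾.dilation 0 x = 0 := by
  simp only [dilation, LinearMap.sum_apply, LinearMap.smul_apply]
  refine Finset.sum_eq_zero fun j hj => ?_
  rw [zero_pow (by simp at hj; omega), zero_smul]

theorem dilation_one_apply (x : G) : 𝔾.dilation 1 x = x := by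
  have hle : ⨆ j, 𝔾.layer j ≤ LinearMap.eqLocus (𝔾.dilation 1) LinearMap.id :=
    iSup_le fun j y hy => by simp [𝔾.dilation_apply_layer _ hy]
  exact hle (by simp [𝔾.iSup_layer])

theorem continuous_dilation [FiniteDimensional ℝ G] :
    Continuous fun p : ℝ × G => 𝔾.dilation p.1 p.2 := by
  simp only [dilation, LinearMap.sum_apply, LinearMap.smul_apply]
  refine continuous_finsetSum _ fun j _ => ?_
  have := (𝔾.proj j).continuous_of_finiteDimensional
  fun_prop

/-! ### The group operation -/

theorem one_le_step : 1 ≤ 𝔾.step := by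
  refine Nat.one_le_iff_ne_zero.2 fun h => 𝔾.layer_step_ne_bot ?_
  rw [h, 𝔾.layer_zero]

/-- The part of `x y` that involves brackets. -/
noncomputable def mulBracketPart (x y : G) : G := ∑ j ∈ Finset.Icc 2 𝔾.step, bchTerm j x y

theorem mul_eq_add (x y : G) : 𝔾.mul x y = x + y + 𝔾.mulBracketPart x y := by
  rw [mul, ← Finset.add_sum_Ioc_eq_sum_Icc 𝔾.one_le_step, bchTerm_one]
  rfl

theorem mulBracketPart_of_mem_span_singleton {u x y : G} (hx : x ∈ ℝ ∙ u) (hy : y ∈ ℝ ∙ u) :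
    𝔾.mulBracketPart x y = 0 :=
  Finset.sum_eq_zero fun _ hj =>
    bchTerm_eq_zero_of_mem_span_singleton (Finset.mem_Icc.1 hj).1 hx hy

theorem mulBracketPart_zero (x : G) : 𝔾.mulBracketPart x 0 = 0 :=
  𝔾.mulBracketPart_of_mem_span_singleton (Submodule.mem_span_singleton_self x)
    (Submodule.zero_mem _)

theorem mul_zero (x : G) : 𝔾.mul x 0 = x := by
  rw [mul_eq_add, mulBracketPart_zero, add_zero, add_zero]

theorem neg_mul_self (x : G) : 𝔾.mul (-x) x = 0 := by
  rw [mul_eq_add, 𝔾.mulBracketPart_of_mem_span_singleton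
    (Submodule.neg_mem _ (Submodule.mem_span_singleton_self x))
    (Submodule.mem_span_singleton_self x), neg_add_cancel, add_zero]

/-- Every term has degree at least two, hence contains a bracket, and each bracket gains one step in
the filtration. -/
theorem mulBracketPart_sub_mem_tail (u : G) {k : ℕ} {x y : G} (h : x - y ∈ 𝔾.tail k) :
    𝔾.mulBracketPart u x - 𝔾.mulBracketPart u y ∈ 𝔾.tail (k + 1) := by
  rw [mulBracketPart, mulBracketPart, ← Finset.sum_sub_distrib]
  exact Submodule.sum_mem _ fun j hj =>
    bchTerm_sub_mem (𝔾.tail_antitone k.le_succ) (fun z w hw => 𝔾.lie_mem_tail z hw)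
      (Finset.mem_Icc.1 hj).1 (by simp) h

theorem differentiable_mulBracketPart [FiniteDimensional ℝ G] {E : Type*} [NormedAddCommGroup E]
    [NormedSpace ℝ E] {f g : E → G} (hf : Differentiable ℝ f) (hg : Differentiable ℝ g) :
    Differentiable ℝ fun v => 𝔾.mulBracketPart (f v) (g v) :=
  Differentiable.fun_sum fun j _ => differentiable_bchTerm j hf hg

theorem continuous_mul_left [FiniteDimensional ℝ G] (u : G) : Continuous fun v => 𝔾.mul u v := by
  simp only [mul_eq_add]
  have := (𝔾.differentiable_mulBracketPart (differentiable_const u) differentiable_id).continuous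
  exact (continuous_const.add continuous_id).add this

theorem IsVerticalSubgroup.exists_tail_le_le_tail {𝔾 : HomogeneousGroup G} {N : Submodule ℝ G}
    (hN : 𝔾.IsVerticalSubgroup N) : ∃ l, 𝔾.tail (l + 1) ≤ N ∧ N ≤ 𝔾.tail l := by
  obtain ⟨l, -, Nl, hNl, rfl⟩ := hN.eq_sup
  refine ⟨l, ?_, ?_⟩
  · refine iSup₂_le fun j hj => ?_
    by_cases hjs : j ≤ 𝔾.step
    · exact le_sup_of_le_right (le_iSup₂_of_le j (Finset.mem_Ioc.2 ⟨hj, hjs⟩) le_rfl)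
    · simp [𝔾.layer_eq_bot j (not_le.1 hjs)]
  · exact sup_le (hNl.trans (𝔾.layer_le_tail le_rfl))
      (iSup₂_le fun j hj => 𝔾.layer_le_tail (Finset.mem_Ioc.1 hj).1.le)

/-- Comparison with `v = 0` puts the bracket part one filtration step below `v`, hence in `N`. The
point `u` ranges over all of `G`, so `v ↦ v + Q(u, v)` is always a self-map of `N`. -/
theorem IsVerticalSubgroup.mulBracketPart_mem {𝔾 : HomogeneousGroup G} {N : Submodule ℝ G}
    (hN : 𝔾.IsVerticalSubgroup N) (u : G) {v : G} (hv : v ∈ N) : 𝔾.mulBracketPart u v ∈ N := by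
  obtain ⟨l, h1, h2⟩ := hN.exists_tail_le_le_tail
  have h := 𝔾.mulBracketPart_sub_mem_tail u (k := l) (x := v) (y := 0) (by simpa using h2 hv)
  rw [mulBracketPart_zero, sub_zero] at h
  exact h1 h

/-! ### Homogeneous distances with convex unit ball -/

namespace IsHomogeneousDistance

variable {𝔾} {d : G → G → ℝ} (hd : 𝔾.IsHomogeneousDistance d)
include hd

theorem nonneg (x y : G) : 0 ≤ d x y := by
  have h := hd.triangle x y x
  rw [hd.dist_self, hd.symm y x] at h
  linarith

theorem dist_neg_mul_zero (x u : G) : d (𝔾.mul (-u) x) 0 = d x u := by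
  rw [← 𝔾.neg_mul_self u, hd.left_invariant]

/-- The central symmetry of the unit ball, needed for the Brunn-Minkowski argument. -/
theorem dist_neg_zero (x : G) : d (-x) 0 = d x 0 := by
  rw [hd.symm x 0, ← hd.dist_neg_mul_zero 0 x, 𝔾.mul_zero]

theorem dist_dilation_zero {r : ℝ} (hr : 0 < r) (x : G) : d (𝔾.dilation r x) 0 = r * d x 0 := by
  simpa using hd.homogeneous r hr x 0

theorem zero_mem_ball : (0 : G) ∈ dClosedBall d 0 1 := by
  simp [dClosedBall, hd.dist_self]

/-- On a single layer a dilation is multiplication by a positive scalar, so a positive multiple of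
every layer vector lies in the ball. -/
theorem span_ball : Submodule.span ℝ (dClosedBall d 0 1) = ⊤ := by
  rw [eq_top_iff, ← 𝔾.iSup_layer]
  refine iSup_le fun j x hx => ?_
  -- The summand `1` avoids a separate case for `x = 0`.
  have hr : 0 < (1 + d x 0)⁻¹ := inv_pos.2 (by linarith [hd.nonneg x 0])
  have hmem : 𝔾.dilation (1 + d x 0)⁻¹ x ∈ dClosedBall d 0 1 := by
    rw [dClosedBall, Set.mem_ofPred_eq, hd.dist_dilation_zero hr]
    have := hd.nonneg x 0
    rw [inv_mul_le_iff₀ (by linarith)]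
    linarith
  rw [𝔾.dilation_apply_layer _ hx] at hmem
  exact (Submodule.smul_mem_iff _ (pow_pos hr j).ne').1 (Submodule.subset_span hmem)

variable [FiniteDimensional ℝ G] (hconv : Convex ℝ (dClosedBall d 0 1))
include hconv

/-- A convex set that contains `0` and spans has an interior point `x`; by symmetry `-x` is interior
too, and `0` is their midpoint. This links `d` to the Euclidean topology. -/
theorem ball_mem_nhds : dClosedBall d 0 1 ∈ 𝓝 (0 : G) := by
  have hne : (interior (dClosedBall d 0 1)).Nonempty := by
    rw [hconv.interior_nonempty_iff_affineSpan_eq_top,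
      AffineSubspace.affineSpan_eq_top_iff_vectorSpan_eq_top_of_nonempty ℝ G G
        ⟨0, hd.zero_mem_ball⟩, vectorSpan_eq_span_vsub_set_right ℝ hd.zero_mem_ball]
    simpa using hd.span_ball
  obtain ⟨x, hx⟩ := hne
  have hneg : -x ∈ interior (dClosedBall d 0 1) := by
    have hpre : (Homeomorph.neg G) ⁻¹' dClosedBall d 0 1 = dClosedBall d 0 1 := by
      ext y
      simp [dClosedBall, hd.dist_neg_zero]
    rw [← hpre, ← Homeomorph.preimage_interior]
    simpa using hx
  have h := hconv.interior hx hneg (a := 1 / 2) (b := 1 / 2) (by norm_num) (by norm_num)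
    (by norm_num)
  rw [smul_neg, add_neg_cancel] at h
  exact mem_interior_iff_mem_nhds.1 h

theorem tendsto_zero : Tendsto (fun x => d x 0) (𝓝 0) (𝓝 0) := by
  rw [Metric.tendsto_nhds]
  intro ε hε
  have hr : 0 < (ε / 2)⁻¹ := by positivity
  have hcont : Continuous (𝔾.dilation (ε / 2)⁻¹) := LinearMap.continuous_of_finiteDimensional _
  have hev : ∀ᶠ x in 𝓝 0, 𝔾.dilation (ε / 2)⁻¹ x ∈ dClosedBall d 0 1 :=
    hcont.continuousAt.eventually_mem (by simpa using hd.ball_mem_nhds hconv)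
  filter_upwards [hev] with x hx
  rw [dClosedBall, Set.mem_ofPred_eq, hd.dist_dilation_zero hr,
    inv_mul_le_iff₀ (by positivity)] at hx
  rw [Real.dist_eq, sub_zero, abs_of_nonneg (hd.nonneg _ _)]
  linarith

theorem continuous_left (u : G) : Continuous fun x => d x u := by
  rw [continuous_iff_continuousAt]
  intro y
  have h1 : Tendsto (fun x => d (𝔾.mul (-y) x) 0) (𝓝 y) (𝓝 0) := by
    refine (hd.tendsto_zero hconv).comp ?_
    simpa [𝔾.neg_mul_self] using (𝔾.continuous_mul_left (-y)).tendsto y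
  rw [ContinuousAt, tendsto_iff_dist_tendsto_zero]
  refine squeeze_zero (fun _ => dist_nonneg) (fun x => ?_) h1
  rw [hd.dist_neg_mul_zero, Real.dist_eq, abs_le]
  have h2 := hd.triangle x y u
  have h3 := hd.triangle y x u
  rw [hd.symm y x] at h3
  constructor <;> linarith

theorem isClosed_ball (u : G) (r : ℝ) : IsClosed (dClosedBall d u r) :=
  isClosed_le (hd.continuous_left hconv u) continuous_const

/-- A point of the ball outside the Euclidean unit ball is moved onto the Euclidean unit sphere by
some `δ_r` with `r ≤ 1`. There `d(·, 0) ≥ m > 0` by compactness, and homogeneity forces `r ≥ m`.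
Such points thus lie in the compact image of `[1, m⁻¹] × sphere` under dilation. -/
theorem isBounded_ball : Bornology.IsBounded (dClosedBall d 0 1) := by
  have hsphere : IsCompact (Metric.sphere (0 : G) 1) := isCompact_sphere 0 1
  obtain ⟨m, hm, hmin⟩ : ∃ m : ℝ, 0 < m ∧ ∀ y ∈ Metric.sphere (0 : G) 1, m ≤ d y 0 := by
    rcases (Metric.sphere (0 : G) 1).eq_empty_or_nonempty with h | h
    · exact ⟨1, one_pos, by simp [h]⟩
    · obtain ⟨z, hz, hz'⟩ := hsphere.exists_isMinOn h (hd.continuous_left hconv 0).continuousOn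
      refine ⟨d z 0, (hd.nonneg z 0).lt_of_ne' fun h0 => ?_, hz'⟩
      rw [hd.eq_of_dist_eq_zero z 0 h0] at hz
      simp at hz
  have hcompact := (isCompact_Icc (a := (1 : ℝ)) (b := m⁻¹)).prod hsphere
  refine (Metric.isBounded_closedBall (x := (0 : G)) (r := 1)).union
    (hcompact.image 𝔾.continuous_dilation).isBounded |>.subset fun x hx => ?_
  rcases le_or_gt ‖x‖ 1 with hx1 | hx1
  · exact Or.inl (by simpa using hx1)
  right
  have hcont : ContinuousOn (fun r : ℝ => ‖𝔾.dilation r x‖) (Set.Icc 0 1) :=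
    (𝔾.continuous_dilation.comp (continuous_id.prodMk continuous_const)).norm.continuousOn
  -- The norm of `δ_r x` runs from `0` at `r = 0` to `‖x‖ > 1` at `r = 1`.
  obtain ⟨r, ⟨hr0, hr1⟩, hr⟩ := intermediate_value_Icc zero_le_one hcont (show (1 : ℝ) ∈ _ by
    simp [dilation_zero_apply, dilation_one_apply, hx1.le])
  have hrpos : 0 < r := hr0.lt_of_ne' fun h0 => by
    simp [h0, dilation_zero_apply] at hr
  have hmr : m ≤ r := by
    have h1 := hmin (𝔾.dilation r x) (by simpa using hr)
    rw [hd.dist_dilation_zero hrpos] at h1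
    have h2 : d x 0 ≤ 1 := hx
    nlinarith
  refine ⟨(r⁻¹, 𝔾.dilation r x), ⟨⟨(one_le_inv₀ hrpos).2 hr1, ?_⟩, by simpa using hr⟩,
    𝔾.dilation_inv_dilation hrpos.ne' x⟩
  exact inv_anti₀ hm hmr

end IsHomogeneousDistance

end HomogeneousGroup

/-! ### Comparison of the sections of the unit balls by a vertical subgroup. -/

namespace HomogeneousGroup

variable {G : Type*} [NormedLieRing G] [InnerLieAlgebra G] [FiniteDimensional ℝ G]
  [MeasurableSpace G] [BorelSpace G] {𝔾 : HomogeneousGroup G}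

theorem IsVerticalSubgroup.addHaar_image_left_translation {N : Submodule ℝ G}
    (hN : 𝔾.IsVerticalSubgroup N) (μ : Measure N) [μ.IsAddHaarMeasure] (u : G) {s : Set N}
    (hs : MeasurableSet s) :
    μ ((fun v : N => v + ⟨𝔾.mulBracketPart u v, hN.mulBracketPart_mem u v.2⟩) '' s) = μ s := by
  -- The shift by one makes the filtration of `N` start at `N` itself, since `tail 1` is the whole
  -- space.
  refine addHaar_image_id_add_of_filtration μ (fun j => (𝔾.tail (j + 1)).comap N.subtype)
    (by simp [tail_one]) (m := 𝔾.step) (by simp [tail_succ_step])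
    (g := fun v : N => ⟨𝔾.mulBracketPart u v, hN.mulBracketPart_mem u v.2⟩) ?_
    (fun j x y h => 𝔾.mulBracketPart_sub_mem_tail u h) hs
  have hE : Differentiable ℝ fun v : N => 𝔾.mulBracketPart u (v : G) :=
    𝔾.differentiable_mulBracketPart (differentiable_const u) N.subtypeL.differentiable
  -- A linear projection onto `N` turns differentiability as a map into `G` into differentiability
  -- as a map into `N`.
  obtain ⟨P, hP⟩ := N.subtype.exists_leftInverse_of_injective N.ker_subtype
  have hcomp : (fun v : N => (⟨𝔾.mulBracketPart u v, hN.mulBracketPart_mem u v.2⟩ : N)) =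
      fun v : N => LinearMap.toContinuousLinearMap P (𝔾.mulBracketPart u v) := by
    funext v
    exact (LinearMap.congr_fun hP ⟨𝔾.mulBracketPart u v, hN.mulBracketPart_mem u v.2⟩).symm
  rw [hcomp]
  exact (LinearMap.toContinuousLinearMap P).differentiable.comp hE

theorem IsHomogeneousDistance.addHaar_preimage_ball_le {d : G → G → ℝ}
    (hd : 𝔾.IsHomogeneousDistance d) (hconv : Convex ℝ (dClosedBall d 0 1)) {N : Submodule ℝ G}
    (hN : 𝔾.IsVerticalSubgroup N) (μ : Measure N) [μ.IsAddHaarMeasure] (u : G) :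
    μ ((↑) ⁻¹' dClosedBall d u 1) ≤ μ ((↑) ⁻¹' dClosedBall d 0 1) := by
  have hval : Continuous ((↑) : N → G) := continuous_subtype_val
  have hmeas : ∀ w, MeasurableSet (((↑) : N → G) ⁻¹' dClosedBall d w 1) := fun w =>
    ((hd.isClosed_ball hconv w 1).preimage hval).measurableSet
  -- The section of the unit ball by the affine plane `N - u`, shifted back into `N`.
  let K : Set N := {v | (v : G) - u ∈ dClosedBall d 0 1}
  have hK : MeasurableSet K :=
    ((hd.isClosed_ball hconv 0 1).preimage (hval.sub continuous_const)).measurableSet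
  have hle : μ ((↑) ⁻¹' dClosedBall d u 1) ≤ μ K := by
    rw [← hN.addHaar_image_left_translation μ (-u) (hmeas u)]
    refine measure_mono ?_
    rintro _ ⟨v, hv, rfl⟩
    have h : d (𝔾.mul (-u) v) 0 ≤ 1 := (hd.dist_neg_mul_zero _ _).trans_le hv
    rw [𝔾.mul_eq_add] at h
    change d ((v : G) + 𝔾.mulBracketPart (-u) v - u) 0 ≤ 1
    convert h using 2
    abel
  have hneg : μ (Neg.neg ⁻¹' K) = μ K := Measure.measure_preimage_neg μ K
  -- For `x ∈ K` and `y ∈ -K`, symmetry puts `x - u` and `y + u` in the unit ball; `u` cancels in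
  -- their midpoint, which lies in `N`.
  have key := addHaar_mul_le_sq_of_midpoint μ hK (measurable_neg hK) (hmeas 0) fun x hx y hy => by
    have hy' : d ((y : G) + u) 0 ≤ 1 := by
      rw [← hd.dist_neg_zero, neg_add, ← sub_eq_add_neg]
      exact hy
    have h := hconv (x := (x : G) - u) hx (y := (y : G) + u) hy' (a := 2⁻¹) (b := 2⁻¹)
      (by norm_num) (by norm_num) (by norm_num)
    rw [← smul_add] at h
    simpa using h
  rw [hneg, ← pow_two] at key
  refine hle.trans (le_of_not_gt fun h => ?_)
  exact absurd key (not_le.2 (by simpa only [pow_two] using ENNReal.mul_lt_mul h h))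

end HomogeneousGroup

/-! ### From Haar measure on the subgroup to Hausdorff measure in the ambient space. -/

/-- The inclusion of `N` is an isometry. When `n` is the dimension of `N`, the measure on the right
is a Haar measure of `N` up to the factor, so the comparison of sections applies. -/
theorem euclideanHausdorff_inter_submodule {G : Type*} [NormedAddCommGroup G]
    [InnerProductSpace ℝ G] [MeasurableSpace G] [BorelSpace G] (N : Submodule ℝ G) (n : ℕ)
    (s : Set G) :
    euclideanHausdorff G n (s ∩ N) = volume (Metric.closedBall (0 : EuclideanSpace ℝ (Fin n)) 1)
      / 2 ^ n * (μH[(n : ℝ)] : Measure N) ((↑) ⁻¹' s) := by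
  rw [isometry_subtype_coe.hausdorffMeasure_preimage (Or.inl n.cast_nonneg), Subtype.range_coe]
  rfl


theorem theorem1p2 {G : Type*} [NormedLieRing G] [InnerLieAlgebra G] [FiniteDimensional ℝ G]
    [MeasurableSpace G] [BorelSpace G] (𝔾 : HomogeneousGroup G)
    (d : G → G → ℝ) (hd : 𝔾.IsHomogeneousDistance d) (hconv : Convex ℝ (dClosedBall d 0 1))
    (n : ℕ) (N : Submodule ℝ G) (hN : 𝔾.IsVerticalSubgroup N) (hn : Module.finrank ℝ N = n) :
    sphericalFactor d N = euclideanHausdorff G n ((N : Set G) ∩ dClosedBall d 0 1) ∧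
      sphericalFactor d N ≠ ⊤ ∧
      IsGreatest ((fun u => euclideanHausdorff G n (dClosedBall d u 1 ∩ (N : Set G))) ''
        dClosedBall d 0 1) (sphericalFactor d N) := by
  subst hn
  have hle : ∀ u, euclideanHausdorff G (Module.finrank ℝ N) (dClosedBall d u 1 ∩ N) ≤
      euclideanHausdorff G (Module.finrank ℝ N) (dClosedBall d 0 1 ∩ N) := fun u => by
    simp only [euclideanHausdorff_inter_submodule]
    exact mul_le_mul' le_rfl
      (hd.addHaar_preimage_ball_le hconv hN μH[(Module.finrank ℝ N : ℝ)] u)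
  have heq : sphericalFactor d N =
      euclideanHausdorff G (Module.finrank ℝ N) (dClosedBall d 0 1 ∩ N) :=
    le_antisymm (iSup₂_le fun u _ => hle u) (le_iSup₂_of_le 0 hd.zero_mem_ball le_rfl)
  refine ⟨by rw [heq, Set.inter_comm], ?_, ?_⟩
  · rw [heq, euclideanHausdorff_inter_submodule]
    refine ENNReal.mul_ne_top (ENNReal.div_ne_top measure_closedBall_lt_top.ne (by simp)) ?_
    have hbdd : Bornology.IsBounded (((↑) : N → G) ⁻¹' dClosedBall d 0 1) :=
      isometry_subtype_coe.antilipschitz.isBounded_preimage (hd.isBounded_ball hconv)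
    exact hbdd.measure_lt_top.ne
  · rw [heq]
    refine ⟨⟨0, hd.zero_mem_ball, rfl⟩, ?_⟩
    rintro _ ⟨u, -, rfl⟩
    exact hle u
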